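/- Let $G=(V,E)$ be a finite connected simple undirected graph with $n=|V|$ vertices (the resources). Consider $m\ge 2$ users and user-independent thresholds $T_v\in\mathbb{Z}_{\ge 0}$, $v\in V$. A state $a\in V^m$ assigns user $i$ to the resource $a_i$; the load of $v$ is $x_v=|\{i : a_i=v\}|$, and $\Phi_v=\max\{x_v-T_v,0\}$. A state is balanced if $x_{a_i}\le T_{a_i}$ for every user $i$. Assume that the thresholds are feasible, i.e. that a balanced state exists. User-controlled protocol with migration parameter $\alpha$: in each round, simultaneously and independently, every user located on a resource $v$ decides with probability $p_v=\alpha\cdot\Phi_v/x_v$ to migrate, in which case it moves to a uniformly random neighbour of $v$; otherwise it stays on $v$. Let $\mathsf{H}(u,v)$ be the expected number of steps in which the simple random walk on $G$ started at $u$ first reaches $v$ (with $\mathsf{H}(u,u)=0$), and let $\mathsf{H}(G)=\max_{u,v\in V}\mathsf{H}(u,v)$. Then there is a universal constant $C>0$ such that for all such $G$, $m$ and $T$ and every initial state, the user-controlled protocol with $\alpha=n^{-5}$ reaches a balanced state after an expected number of at most $C\cdot n^5\cdot\mathsf{H}(G)\cdot\log m$ rounds. -/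

import Mathlib

open scoped ENNReal NNReal

noncomputable section

namespace ThresholdBalancing

/-! ### Finite Markov chains and expected hitting times -/

section Chain

/-- The (time-homogeneous) transition kernel of the Markov chain with transition probabilities `P`:
given the history up to time `t`, the next state is distributed as `P` of the current state. -/
def historyKernel {S : Type*} [Finite S] [MeasurableSpace S] [DiscreteMeasurableSpace S]
    (P : S → PMF S) (t : ℕ) :
    ProbabilityTheory.Kernel ((i : Finset.Iic t) → S) S :=
  ProbabilityTheory.Kernel.ofFunOfCountable
    (fun history => (P (history ⟨t, Finset.mem_Iic.2 le_rfl⟩)).toMeasure)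

instance {S : Type*} [Finite S] [MeasurableSpace S] [DiscreteMeasurableSpace S]
    (P : S → PMF S) (t : ℕ) : ProbabilityTheory.IsMarkovKernel (historyKernel P t) :=
  ⟨fun _ => PMF.toMeasure.isProbabilityMeasure _⟩

/-- The law on trajectories `ℕ → S` of the Markov chain with transition probabilities `P`
started in the state `s`. -/
def chainLaw {S : Type*} [Finite S] [MeasurableSpace S] [DiscreteMeasurableSpace S]
    (P : S → PMF S) (s : S) : MeasureTheory.Measure (ℕ → S) :=
  ProbabilityTheory.Kernel.trajMeasure (X := fun _ => S) (MeasureTheory.Measure.dirac s)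
    (historyKernel P)

/-- The expected first time (at least `0`, possibly `∞`) at which the Markov chain with transition
probabilities `P` started in `s` is in the set `A`. -/
def expectedHittingTime {S : Type*} [Finite S] (P : S → PMF S) (A : Set S) (s : S) : ℝ≥0∞ :=
  letI : MeasurableSpace S := ⊤
  ∫⁻ ω, ENat.toENNReal (MeasureTheory.hittingAfter (fun (t : ℕ) (ω : ℕ → S) => ω t) A 0 ω)
    ∂(chainLaw P s)

end Chain

section Graph

variable {V : Type*} [Fintype V] [DecidableEq V] (G : SimpleGraph V) [DecidableRel G.Adj]

/-- One step of the random walk on `G`: a uniformly random neighbour of `u`. (An isolated vertex,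
which in a connected graph only exists if the graph has one vertex, is never left.) -/
def randomNeighbor (u : V) : PMF V :=
  if h : (G.neighborFinset u).Nonempty then PMF.uniformOfFinset (G.neighborFinset u) h
  else PMF.pure u

/-- The maximum hitting time `H(G) = max_{u,v} H(u,v)` of the random walk on `G`. -/
def maxHittingTime : ℝ≥0∞ :=
  ⨆ (u : V) (v : V), expectedHittingTime (randomNeighbor G) {v} u

end Graph

section Protocol

variable {V : Type*} [DecidableEq V] {m : ℕ}

/-- The load `x_v` of resource `v` in the state `a`. -/
def load (a : Fin m → V) (v : V) : ℕ := (Finset.univ.filter (fun i => a i = v)).card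

/-- A state is balanced for the user-independent thresholds `T` if every user is on a resource whose
load is at most its threshold. -/
def IsBalanced (T : V → ℕ) (a : Fin m → V) : Prop := ∀ i, load a (a i) ≤ T (a i)

/-- The thresholds `T` are feasible for `m` users if they allow a balanced state. -/
def IsFeasible (T : V → ℕ) (m : ℕ) : Prop := ∃ a : Fin m → V, IsBalanced T a

/-- The potential `Φ_v = max (x_v - T_v) 0` of resource `v`. -/
def potential (T : V → ℕ) (a : Fin m → V) (v : V) : ℕ := load a v - T v

/-- The probability `α · Φ_v / x_v` with which each user on resource `v` decides to migrate. -/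
def migrationProb (α : ℝ≥0) (T : V → ℕ) (a : Fin m → V) (v : V) : ℝ≥0 :=
  α * ((potential T a v : ℝ≥0) / (load a v : ℝ≥0))

theorem migrationProb_le_one {α : ℝ≥0} (hα : α ≤ 1) (T : V → ℕ) (a : Fin m → V) (v : V) :
    migrationProb α T a v ≤ 1 := by
  refine mul_le_one' hα (div_le_one_of_le₀ ?_ zero_le)
  exact_mod_cast Nat.sub_le _ _

variable [Fintype V] (G : SimpleGraph V) [DecidableRel G.Adj]

/-- The biased coin which shows `true` with probability `p`. -/
def coin (p : ℝ≥0) (hp : p ≤ 1) : PMF Bool :=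
  PMF.ofFintype (fun b => if b then (p : ℝ≥0∞) else 1 - (p : ℝ≥0∞)) (by
    simpa using add_tsub_cancel_of_le (ENNReal.coe_le_one_iff.2 hp))

/-- The distribution of the resource of user `i` after one round started in the state `a`: with
the migration probability of its current resource the user moves to a uniformly random neighbour,
and otherwise it stays. -/
def userStep (α : ℝ≥0) (hα : α ≤ 1) (T : V → ℕ) (a : Fin m → V) (i : Fin m) : PMF V :=
  (coin (migrationProb α T a (a i)) (migrationProb_le_one hα T a (a i))).bind
    (fun migrate => if migrate then randomNeighbor G (a i) else PMF.pure (a i))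

/-- The distribution of the state after one round started in the state `a`: all users act
simultaneously and independently. -/
def protocolStep (α : ℝ≥0) (hα : α ≤ 1) (T : V → ℕ) (a : Fin m → V) : PMF (Fin m → V) :=
  PMF.ofFintype (fun b => ∏ i, userStep G α hα T a i (b i)) (by
    rw [← Fintype.prod_sum]
    refine Finset.prod_eq_one fun i _ => ?_
    rw [← tsum_fintype (L := SummationFilter.unconditional V)]
    exact (userStep G α hα T a i).tsum_coe)

/-- The expected number of rounds until the user-controlled protocol with migration parameter `α`,
started in the state `a`, reaches a balanced state. -/
def expectedRounds (α : ℝ≥0) (hα : α ≤ 1) (T : V → ℕ) (a : Fin m → V) : ℝ≥0∞ :=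
  expectedHittingTime (protocolStep G α hα T) {b | IsBalanced T b} a

end Protocol

/-- The migration parameter `n⁻⁵` is at most `1`. -/
theorem inv_pow_five_le_one (n : ℕ) : ((n : ℝ≥0) ^ 5)⁻¹ ≤ 1 := by
  rcases Nat.eq_zero_or_pos n with rfl | hn
  · simp
  · exact inv_le_one_of_one_le₀ (one_le_pow₀ (by exact_mod_cast hn))

end ThresholdBalancing

end

/-! The proof is a multiplicative drift argument for an optimal transport cost. Moving a user from u
to v costs 0 if u = v and 1 + H(u,v)/(2 H(G)) otherwise, and W(a) is the least total cost of turning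
a into a balanced state. Nonzero costs lie in [1, 3/2], so one move is always cheaper than two.
Hence an optimal plan moves exactly Φ_v users away from each v (`card_moved_eq_potential`), and W is
at most 3/2 times the sum of the Φ_v. A random step of a user away from its target lowers the
expected cost by at least ε = 1/(2 H(G)) (`sum_mul_hittingCost_le`).

Users on one resource are interchangeable. So, once the set M of migrants is known but not yet their
destinations, the plan can be chosen to move migrants first (`exists_optimal_priority`). Each
migrant then gains ε in expectation, except the superfluous ones, which the plan wants to stay and
which lose at most 3/2. A superfluous migrant on v shares v with Φ_v other migrants; since p_v = α
Φ_v / x_v, a count of pairs shows that the superfluous migrants are in expectation at most an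
α-fraction of all migrants. Thus W drops in expectation by at least (ε - 2α) α ∑ Φ_v, which is at
least (α ε / 3) W when 4α ≤ ε. For α = n⁻⁵ this condition follows from H(G) ≤ n²(n - 1).

Finally W is 0 at balanced states, at least 1 elsewhere and at most 3m/2, so logarithmic drift gives
expected time O(log m / (α ε)). -/

namespace ThresholdBalancing

/-! ### Expected hitting times: tail sums, first-step equation, drift bound -/

section HittingTimes

open MeasureTheory ProbabilityTheory

variable {S : Type*} [Finite S]

/-- The operator `g ↦ P (1_{Aᶜ} g)` of the Markov chain killed in `A`. -/
noncomputable def killedStep (P : S → PMF S) (A : Set S) (g : S → ℝ≥0∞) (s : S) : ℝ≥0∞ :=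
  ∑' s', P s s' * Aᶜ.indicator g s'

theorem lintegral_chainLaw_zero [MeasurableSpace S] [DiscreteMeasurableSpace S] (P : S → PMF S)
    (s : S) (g : S → ℝ≥0∞) : ∫⁻ ω, g (ω 0) ∂chainLaw P s = g s := by
  have hm : Measurable (fun x : (i : Finset.Iic 0) → S => g (x ⟨0, Finset.mem_Iic.2 le_rfl⟩)) :=
    Measurable.of_discrete.comp (measurable_pi_apply _)
  have h : (chainLaw P s).map (Preorder.frestrictLe 0) =
      (Measure.dirac s).map (MeasurableEquiv.piUnique (fun _ : Finset.Iic 0 => S)).symm := by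
    rw [chainLaw, Kernel.trajMeasure, Measure.map_comp _ _ (by fun_prop),
      Kernel.traj_map_frestrictLe, Kernel.partialTraj_self, Measure.id_comp]
  have h1 : ∫⁻ ω, g (ω 0) ∂chainLaw P s =
      ∫⁻ x, g (x ⟨0, Finset.mem_Iic.2 le_rfl⟩) ∂((chainLaw P s).map (Preorder.frestrictLe 0)) := by
    rw [lintegral_map hm (by fun_prop)]
    rfl
  rw [h1, h, lintegral_map hm (by fun_prop), lintegral_dirac]
  rfl

/-- The Markov property: `B` is an event of the history up to time `n`, and the next state is
integrated out. -/
theorem lintegral_chainLaw_succ [MeasurableSpace S] [DiscreteMeasurableSpace S] (P : S → PMF S)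
    (s : S) (n : ℕ) (B : Set ((i : Finset.Iic n) → S)) (g : S → ℝ≥0∞) :
    ∫⁻ ω, B.indicator 1 (Preorder.frestrictLe (π := fun _ => S) n ω) * g (ω (n + 1)) ∂chainLaw P s =
      ∫⁻ ω, B.indicator 1 (Preorder.frestrictLe (π := fun _ => S) n ω) * ∑' s', P (ω n) s' * g s'
        ∂chainLaw P s := by
  have key := Kernel.map_frestrictLe_trajMeasure_compProd_eq_map_trajMeasure (X := fun _ => S)
    (μ₀ := Measure.dirac s) (κ := historyKernel P) (a := n)
  have hB : Measurable (B.indicator (1 : ((i : Finset.Iic n) → S) → ℝ≥0∞)) :=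
    measurable_one.indicator (Set.toFinite B).measurableSet
  have hg : Measurable g := Measurable.of_discrete
  have hm : Measurable (fun p : ((i : Finset.Iic n) → S) × S => B.indicator 1 p.1 * g p.2) := by
    fun_prop
  have h1 := congrArg (fun μ => ∫⁻ p, B.indicator 1 p.1 * g p.2 ∂μ) key
  rw [lintegral_map hm (by fun_prop), Measure.lintegral_compProd hm] at h1
  refine Eq.trans h1.symm ?_
  have hm2 : Measurable (fun x : (i : Finset.Iic n) → S =>
      ∫⁻ y, B.indicator 1 x * g y ∂(historyKernel P n x)) := by
    exact Measurable.of_discrete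
  rw [lintegral_map hm2 (by fun_prop)]
  refine lintegral_congr fun ω => ?_
  rw [lintegral_const_mul _ hg]
  congr 1
  have : ∀ p : PMF S, ∫⁻ y, g y ∂p.toMeasure = ∑' s', p s' * g s' := by
    intro p
    have := Fintype.ofFinite S
    rw [lintegral_fintype, tsum_fintype]
    refine Finset.sum_congr rfl fun y _ => ?_
    rw [PMF.toMeasure_apply_singleton _ _ (MeasurableSet.singleton y), mul_comm]
  exact this _

theorem lintegral_chainLaw_killed [MeasurableSpace S] [DiscreteMeasurableSpace S] (P : S → PMF S)
    (A : Set S) (s : S) (n : ℕ) (g : S → ℝ≥0∞) :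
    ∫⁻ ω, {ω : ℕ → S | ∀ j ≤ n, ω j ∉ A}.indicator (fun ω => g (ω n)) ω ∂chainLaw P s =
      Aᶜ.indicator ((killedStep P A)^[n] g) s := by
  classical
  induction n generalizing g with
  | zero =>
    rw [Function.iterate_zero, id, ← lintegral_chainLaw_zero P s (Aᶜ.indicator g)]
    refine lintegral_congr fun ω => ?_
    simp [Set.indicator]
  | succ n ih =>
    rw [Function.iterate_succ_apply, ← ih]
    set B : Set ((i : Finset.Iic n) → S) := {x | ∀ i, x i ∉ A}
    have hB : ∀ ω : ℕ → S, Preorder.frestrictLe (π := fun _ => S) n ω ∈ B ↔ ∀ j ≤ n, ω j ∉ A := by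
      intro ω
      simp only [B, Set.mem_ofPred_eq, Subtype.forall, Finset.mem_Iic]
      rfl
    have := lintegral_chainLaw_succ P s n B (Aᶜ.indicator g)
    convert this using 1
    · refine lintegral_congr fun ω => ?_
      simp only [Set.indicator, hB, Set.mem_ofPred_eq, Set.mem_compl_iff, Pi.one_apply,
        Nat.le_succ_iff]
      by_cases h1 : ∀ j ≤ n, ω j ∉ A <;> by_cases h2 : ω (n + 1) ∉ A <;>
        simp [h1, h2, or_imp, forall_and]
    · refine lintegral_congr fun ω => ?_
      simp only [Set.indicator, hB, Set.mem_ofPred_eq, Pi.one_apply, ite_mul, one_mul, zero_mul]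
      rfl

omit [Finite S] in
theorem toENNReal_hittingAfter_zero (A : Set S) (ω : ℕ → S) :
    ENat.toENNReal (hittingAfter (fun (t : ℕ) (ω : ℕ → S) => ω t) A 0 ω) =
      ∑' n : ℕ, {ω : ℕ → S | ∀ j ≤ n, ω j ∉ A}.indicator (1 : (ℕ → S) → ℝ≥0∞) ω := by
  classical
  set τ : ℕ∞ := hittingAfter (fun (t : ℕ) (ω : ℕ → S) => ω t) A 0 ω with hτ
  have h : ∀ n : ℕ, (∀ j ≤ n, ω j ∉ A) ↔ (n : ℕ∞) < τ := by
    intro n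
    have := hittingAfter_le_iff (u := fun (t : ℕ) (ω : ℕ → S) => ω t) (s := A) (n := 0) (i := n)
      (ω := ω)
    have h2 : τ ≤ (n : ℕ∞) ↔ ∃ j ∈ Set.Icc 0 n, ω j ∈ A := this
    rw [← not_le, h2]
    simp
  simp only [Set.indicator, Set.mem_ofPred_eq, h, Pi.one_apply]
  clear_value τ
  induction τ using ENat.recTopCoe with
  | top => simp
  | coe k =>
    simp only [Nat.cast_lt, ENat.toENNReal_coe]
    rw [tsum_eq_sum (s := Finset.range k) (by simp)]
    rw [Finset.sum_congr rfl (g := fun _ => 1) (by simp +contextual)]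
    simp

/-- The expectation is the sum of the tails; the probability of avoiding `A` up to time `n` is the
`n`-th power of the killed operator applied to 1. -/
theorem expectedHittingTime_eq_tsum (P : S → PMF S) (A : Set S) (s : S) :
    expectedHittingTime P A s = ∑' n : ℕ, Aᶜ.indicator ((killedStep P A)^[n] 1) s := by
  let _ : MeasurableSpace S := ⊤
  have hA : ∀ n : ℕ, MeasurableSet {ω : ℕ → S | ∀ j ≤ n, ω j ∉ A} := by
    intro n
    have : {ω : ℕ → S | ∀ j ≤ n, ω j ∉ A} = ⋂ j ≤ n, (fun ω : ℕ → S => ω j) ⁻¹' Aᶜ := by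
      ext; simp
    rw [this]
    exact MeasurableSet.iInter fun j => MeasurableSet.iInter fun _ =>
      (measurable_pi_apply j) (MeasurableSet.of_discrete)
  unfold expectedHittingTime
  simp_rw [toENNReal_hittingAfter_zero]
  rw [lintegral_tsum fun n => (measurable_one.indicator (hA n)).aemeasurable]
  exact tsum_congr fun n => lintegral_chainLaw_killed P A s n 1

theorem expectedHittingTime_of_mem (P : S → PMF S) {A : Set S} {s : S} (hs : s ∈ A) :
    expectedHittingTime P A s = 0 := by
  rw [expectedHittingTime_eq_tsum]
  simp [hs]

theorem expectedHittingTime_of_notMem (P : S → PMF S) {A : Set S} {s : S} (hs : s ∉ A) :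
    expectedHittingTime P A s = 1 + ∑' s', P s s' * expectedHittingTime P A s' := by
  simp_rw [expectedHittingTime_eq_tsum]
  rw [tsum_eq_zero_add' ENNReal.summable]
  simp_rw [← ENNReal.tsum_mul_left]
  rw [ENNReal.tsum_comm]
  simp [hs, Function.iterate_succ_apply', killedStep]

/-- The partial sums are the expected hitting times truncated at a finite horizon. Bounding these by
induction on the horizon needs no prior finiteness. -/
theorem expectedHittingTime_le_of_drift (P : S → PMF S) (A : Set S) (L : S → ℝ≥0∞)
    (hL : ∀ s ∉ A, 1 + ∑' s', P s s' * L s' ≤ L s) (s : S) : expectedHittingTime P A s ≤ L s := by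
  rw [expectedHittingTime_eq_tsum]
  refine ENNReal.tsum_le_of_sum_range_le fun N => ?_
  induction N generalizing s with
  | zero => simp
  | succ N ih =>
    by_cases hs : s ∈ A
    · simp [hs]
    · refine le_trans ?_ (hL s hs)
      rw [Finset.sum_range_succ', add_comm]
      refine add_le_add (by simp [hs]) ?_
      refine le_trans (le_of_eq ?_) (ENNReal.tsum_le_tsum fun s' => mul_le_mul_right (ih s') _)
      simp_rw [Finset.mul_sum]
      rw [Summable.tsum_finsetSum fun _ _ => ENNReal.summable]
      simp [hs, Function.iterate_succ_apply', killedStep]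

end HittingTimes

/-! ### Hitting times of the random walk and the induced cost -/

section RandomWalk

variable {V : Type*} [Fintype V] [DecidableEq V] (G : SimpleGraph V) [DecidableRel G.Adj]

/-- A function that decreases by one in expectation along the random walk, except at its zero `v`,
drops by at most `n²` along every edge. -/
theorem le_add_sq_of_adj {h : V → ℝ} {v : V} (h0 : ∀ u, 0 ≤ h u) (hv : h v = 0)
    (hh : ∀ u, u ≠ v → (G.degree u : ℝ) * h u = G.degree u + ∑ w ∈ G.neighborFinset u, h w)
    {x y : V} (hxy : G.Adj x y) : h x ≤ h y + (Fintype.card V : ℝ) ^ 2 := by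
  rcases le_or_gt (h x) (h y) with hle | hlt
  · exact hle.trans (le_add_of_nonneg_right (by positivity))
  -- Read `F` as a flow along edges, given by differences of `h`. Each vertex of the level set `S`
  -- emits its degree, and flow inside `S` cancels by antisymmetry. So the flow across the cut is a
  -- sum of degrees, at most n². Every cut term is nonnegative, hence the edge from x to y alone
  -- carries at most n².
  set S : Finset V := Finset.univ.filter fun u => h y < h u with hS
  set F : V → V → ℝ := fun a b => if G.Adj a b then h a - h b else 0 with hF
  have hanti : ∀ a b, F a b = -F b a := by
    intro a b
    simp only [hF, G.adj_comm b a]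
    split_ifs <;> ring
  have hrow : ∀ u ∈ S, ∑ w, F u w = G.degree u := by
    intro u hu
    have hne : u ≠ v := by
      rintro rfl
      rw [hS, Finset.mem_filter, hv] at hu
      exact absurd hu.2 (not_lt.2 (h0 y))
    have e : ∑ w, F u w = ∑ w ∈ G.neighborFinset u, (h u - h w) := by
      rw [← Finset.sum_filter]
      refine Finset.sum_congr ?_ fun _ _ => rfl
      ext w
      simp
    rw [e, Finset.sum_sub_distrib, Finset.sum_const, G.card_neighborFinset_eq_degree, nsmul_eq_mul,
      hh u hne]
    ring
  have hin : ∑ u ∈ S, ∑ w ∈ S, F u w = 0 := by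
    have h1 : ∑ u ∈ S, ∑ w ∈ S, F u w = -∑ u ∈ S, ∑ w ∈ S, F u w := by
      conv_lhs => rw [Finset.sum_comm]
      rw [← Finset.sum_neg_distrib]
      refine Finset.sum_congr rfl fun a _ => ?_
      rw [← Finset.sum_neg_distrib]
      exact Finset.sum_congr rfl fun b _ => hanti b a
    linarith
  have hout : ∀ u ∈ S, ∀ w ∈ Sᶜ, 0 ≤ F u w := by
    intro u hu w hw
    simp only [hS, Finset.mem_compl, Finset.mem_filter, Finset.mem_univ, true_and, not_lt] at hu hw
    simp only [hF]
    split_ifs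
    · linarith
    · rfl
  have hsplit : ∑ u ∈ S, ∑ w ∈ Sᶜ, F u w = ∑ u ∈ S, (G.degree u : ℝ) := by
    rw [← Finset.sum_congr rfl hrow]
    simp_rw [← fun u => Finset.sum_add_sum_compl S (F u)]
    rw [Finset.sum_add_distrib, hin, zero_add]
  have hdeg : ∑ u ∈ S, (G.degree u : ℝ) ≤ (Fintype.card V : ℝ) ^ 2 := by
    calc ∑ u ∈ S, (G.degree u : ℝ) ≤ ∑ _u ∈ S, (Fintype.card V : ℝ) :=
          Finset.sum_le_sum fun u _ => by exact_mod_cast (G.degree_lt_card_verts u).le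
      _ ≤ (Fintype.card V : ℝ) ^ 2 := by
          rw [Finset.sum_const, nsmul_eq_mul, sq]
          exact mul_le_mul_of_nonneg_right (by exact_mod_cast Finset.card_le_univ S) (by positivity)
  have hxS : x ∈ S := by simp [hS, hlt]
  have hyS : y ∈ Sᶜ := by simp [hS]
  have h1 : F x y ≤ ∑ u ∈ S, ∑ w ∈ Sᶜ, F u w :=
    (Finset.single_le_sum (hout x hxS) hyS).trans
      (Finset.single_le_sum (f := fun u => ∑ w ∈ Sᶜ, F u w)
        (fun u hu => Finset.sum_nonneg (hout u hu)) hxS)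
  have h2 : F x y = h x - h y := if_pos hxy
  linarith

/-- The bound per edge is added up along a path to `v`, which has at most n - 1 edges. -/
theorem le_card_sq_mul (hG : G.Connected) {h : V → ℝ} {v : V} (h0 : ∀ u, 0 ≤ h u) (hv : h v = 0)
    (hh : ∀ u, u ≠ v → (G.degree u : ℝ) * h u = G.degree u + ∑ w ∈ G.neighborFinset u, h w)
    (u : V) : h u ≤ (Fintype.card V : ℝ) ^ 2 * (Fintype.card V - 1) := by
  have hwalk : ∀ {a b : V} (p : G.Walk a b), h a ≤ h b + (Fintype.card V : ℝ) ^ 2 * p.length := by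
    intro a b p
    induction p with
    | nil => simp
    | cons hab p ih =>
      have := le_add_sq_of_adj G h0 hv hh hab
      rw [SimpleGraph.Walk.length_cons]
      push_cast
      linarith
  obtain ⟨p, hp⟩ := hG.exists_isPath u v
  have hlen : (p.length : ℝ) ≤ Fintype.card V - 1 := by
    have := hp.length_lt
    rw [le_sub_iff_add_le]
    exact_mod_cast this
  have := hwalk p
  rw [hv, zero_add] at this
  exact this.trans (mul_le_mul_of_nonneg_left hlen (by positivity))

theorem tsum_randomNeighbor_mul {u : V} (hu : (G.neighborFinset u).Nonempty) (g : V → ℝ≥0∞) :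
    ∑' w, randomNeighbor G u w * g w =
      (G.degree u : ℝ≥0∞)⁻¹ * ∑ w ∈ G.neighborFinset u, g w := by
  rw [tsum_fintype, randomNeighbor, dif_pos hu, Finset.mul_sum]
  simp_rw [PMF.uniformOfFinset_apply, ite_mul, zero_mul, G.card_neighborFinset_eq_degree]
  rw [← Finset.sum_filter]
  refine Finset.sum_congr ?_ fun _ _ => rfl
  ext w
  simp

omit [DecidableEq V] in
theorem expectedHittingTime_le_maxHittingTime (u v : V) :
    expectedHittingTime (randomNeighbor G) {v} u ≤ maxHittingTime G :=
  le_iSup₂ (f := fun u v => expectedHittingTime (randomNeighbor G) {v} u) u v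

omit [DecidableEq V] in
theorem neighborFinset_nonempty [Nontrivial V] (hG : G.Connected) (u : V) :
    (G.neighborFinset u).Nonempty := by
  rw [← Finset.card_pos, G.card_neighborFinset_eq_degree]
  exact hG.preconnected.degree_pos_of_nontrivial u

/-- The hitting time of `v` from `u` as a real number. -/
noncomputable def hittingTimeReal (u v : V) : ℝ :=
  (expectedHittingTime (randomNeighbor G) {v} u).toReal

variable {G}

omit [DecidableEq V] in
theorem hittingTimeReal_self (v : V) : hittingTimeReal G v v = 0 := by
  rw [hittingTimeReal, expectedHittingTime_of_mem _ (Set.mem_singleton v), ENNReal.toReal_zero]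

omit [DecidableEq V] in
theorem hittingTimeReal_eq (hH : maxHittingTime G ≠ ∞) {u v : V} (huv : u ≠ v) :
    hittingTimeReal G u v = 1 + ∑ w, (randomNeighbor G u w).toReal * hittingTimeReal G w v := by
  have hfin : ∀ w, expectedHittingTime (randomNeighbor G) {v} w ≠ ∞ := fun w =>
    ne_top_of_le_ne_top hH (expectedHittingTime_le_maxHittingTime G w v)
  have hfin2 : ∀ w, randomNeighbor G u w * expectedHittingTime (randomNeighbor G) {v} w ≠ ∞ :=
    fun w => ENNReal.mul_ne_top (PMF.apply_ne_top _ _) (hfin w)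
  rw [hittingTimeReal, expectedHittingTime_of_notMem _ (by simpa using huv), tsum_fintype,
    ENNReal.toReal_add ENNReal.one_ne_top (ENNReal.sum_ne_top.2 fun w _ => hfin2 w),
    ENNReal.toReal_sum fun w _ => hfin2 w]
  simp_rw [ENNReal.toReal_mul]
  simp [hittingTimeReal]

theorem degree_mul_hittingTimeReal [Nontrivial V] (hG : G.Connected) (hH : maxHittingTime G ≠ ∞)
    {u v : V} (huv : u ≠ v) :
    (G.degree u : ℝ) * hittingTimeReal G u v =
      G.degree u + ∑ w ∈ G.neighborFinset u, hittingTimeReal G w v := by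
  have hfin : ∀ w, expectedHittingTime (randomNeighbor G) {v} w ≠ ∞ := fun w =>
    ne_top_of_le_ne_top hH (expectedHittingTime_le_maxHittingTime G w v)
  have hd : (G.degree u : ℝ) ≠ 0 := by
    have := hG.preconnected.degree_pos_of_nontrivial u
    positivity
  have e : hittingTimeReal G u v =
      1 + (G.degree u : ℝ)⁻¹ * ∑ w ∈ G.neighborFinset u, hittingTimeReal G w v := by
    have hS : ∑ w ∈ G.neighborFinset u, expectedHittingTime (randomNeighbor G) {v} w ≠ ∞ :=
      ENNReal.sum_ne_top.2 fun w _ => hfin w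
    have hd' : (G.degree u : ℝ≥0∞)⁻¹ ≠ ∞ := ENNReal.inv_ne_top.2 (by exact_mod_cast hd)
    rw [hittingTimeReal, expectedHittingTime_of_notMem _ (by simpa using huv),
      tsum_randomNeighbor_mul G (neighborFinset_nonempty G hG u),
      ENNReal.toReal_add ENNReal.one_ne_top (ENNReal.mul_ne_top hd' hS), ENNReal.toReal_mul,
      ENNReal.toReal_sum fun w _ => hfin w]
    simp [hittingTimeReal]
  rw [e]
  field_simp

theorem sum_toReal_eq_one {S : Type*} [Fintype S] (p : PMF S) : ∑ s, (p s).toReal = 1 := by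
  rw [← ENNReal.toReal_sum fun s _ => PMF.apply_ne_top _ _, ← tsum_fintype (L := .unconditional S),
    p.tsum_coe, ENNReal.toReal_one]

omit [DecidableEq V] in
theorem one_le_maxHittingTime [Nontrivial V] : 1 ≤ maxHittingTime G := by
  obtain ⟨u, v, huv⟩ := exists_pair_ne V
  refine le_trans ?_ (expectedHittingTime_le_maxHittingTime G u v)
  rw [expectedHittingTime_of_notMem _ (by simpa using huv)]
  exact le_self_add

theorem maxHittingTime_toReal_le [Nontrivial V] (hG : G.Connected) (hH : maxHittingTime G ≠ ∞) :
    (maxHittingTime G).toReal ≤ (Fintype.card V : ℝ) ^ 2 * (Fintype.card V - 1) := by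
  have hn : (1 : ℝ) ≤ Fintype.card V := by exact_mod_cast Fintype.card_pos
  have h0 : 0 ≤ (Fintype.card V : ℝ) ^ 2 * (Fintype.card V - 1) :=
    mul_nonneg (by positivity) (by linarith)
  refine ENNReal.toReal_le_of_le_ofReal h0 (iSup₂_le fun u v => ?_)
  rw [← ENNReal.ofReal_toReal
    (ne_top_of_le_ne_top hH (expectedHittingTime_le_maxHittingTime G u v))]
  exact ENNReal.ofReal_le_ofReal (le_card_sq_mul G hG (h := fun u => hittingTimeReal G u v)
    (fun _ => ENNReal.toReal_nonneg) (hittingTimeReal_self v)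
    (fun u hu => degree_mul_hittingTimeReal hG hH hu) u)

variable (G) in
/-- The cost of a pair of resources: `0` on the diagonal, and otherwise an affine function of the
hitting time with values in `[1, 3/2]`. -/
noncomputable def hittingCost (u v : V) : ℝ :=
  if u = v then 0 else 1 + hittingTimeReal G u v / (2 * (maxHittingTime G).toReal)

theorem hittingCost_self (v : V) : hittingCost G v v = 0 := if_pos rfl

theorem one_le_hittingCost {u v : V} (huv : u ≠ v) : 1 ≤ hittingCost G u v := by
  rw [hittingCost, if_neg huv]
  have : 0 ≤ hittingTimeReal G u v := ENNReal.toReal_nonneg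
  have : 0 ≤ (maxHittingTime G).toReal := ENNReal.toReal_nonneg
  linarith [show 0 ≤ hittingTimeReal G u v / (2 * (maxHittingTime G).toReal) by positivity]

theorem hittingCost_le (hH : maxHittingTime G ≠ ∞) (u v : V) : hittingCost G u v ≤ 3 / 2 := by
  rw [hittingCost]
  split_ifs
  · norm_num
  have h1 : hittingTimeReal G u v ≤ (maxHittingTime G).toReal :=
    ENNReal.toReal_mono hH (expectedHittingTime_le_maxHittingTime G u v)
  have h2 : hittingTimeReal G u v / (2 * (maxHittingTime G).toReal) ≤ 1 / 2 := by
    rw [← div_div, div_right_comm]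
    exact div_le_div_of_nonneg_right (div_le_one_of_le₀ h1 ENNReal.toReal_nonneg) (by norm_num)
      |>.trans_eq' (by ring)
  linarith

/-- Averaging over neighbours keeps the constant 1 and lowers the hitting time by exactly one.
Replacing the cost by its affine formula on the diagonal too only increases it there, from 0 to 1.
-/
theorem sum_mul_hittingCost_le [Nontrivial V] (hH : maxHittingTime G ≠ ∞) {u v : V} (huv : u ≠ v) :
    ∑ w, (randomNeighbor G u w).toReal * hittingCost G w v ≤
      hittingCost G u v - 1 / (2 * (maxHittingTime G).toReal) := by
  set D := 2 * (maxHittingTime G).toReal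
  have hle : ∀ w, hittingCost G w v ≤ 1 + hittingTimeReal G w v / D := by
    intro w
    rw [hittingCost]
    split_ifs with h
    · rw [h, hittingTimeReal_self]; simp
    · rfl
  calc ∑ w, (randomNeighbor G u w).toReal * hittingCost G w v
      ≤ ∑ w, (randomNeighbor G u w).toReal * (1 + hittingTimeReal G w v / D) :=
        Finset.sum_le_sum fun w _ => mul_le_mul_of_nonneg_left (hle w) ENNReal.toReal_nonneg
    _ = ∑ w, (randomNeighbor G u w).toReal +
          (∑ w, (randomNeighbor G u w).toReal * hittingTimeReal G w v) / D := by
        rw [Finset.sum_div, ← Finset.sum_add_distrib]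
        exact Finset.sum_congr rfl fun w _ => by ring
    _ = hittingCost G u v - 1 / D := by
        rw [sum_toReal_eq_one, hittingCost, if_neg huv, hittingTimeReal_eq hH huv]
        ring

end RandomWalk

/-! ### Optimal transport to a balanced state -/

section TransportCost

variable {V : Type*} [DecidableEq V] {m : ℕ} {T : V → ℕ}

theorem isBalanced_iff {a : Fin m → V} : IsBalanced T a ↔ ∀ v, load a v ≤ T v := by
  refine ⟨fun h v => ?_, fun h i => h (a i)⟩
  by_cases hv : ∃ i, a i = v
  · obtain ⟨i, rfl⟩ := hv
    exact h i
  · have : load a v = 0 := by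
      rw [load, Finset.card_eq_zero, Finset.filter_eq_empty_iff]
      exact fun i _ hi => hv ⟨i, hi⟩
    omega

theorem load_comp_perm (b : Fin m → V) (σ : Equiv.Perm (Fin m)) (v : V) :
    load (b ∘ σ) v = load b v :=
  Finset.card_equiv σ (by simp)

theorem IsBalanced.comp_perm {b : Fin m → V} (hb : IsBalanced T b) (σ : Equiv.Perm (Fin m)) :
    IsBalanced T (b ∘ σ) :=
  isBalanced_iff.2 fun v => (load_comp_perm b σ v).trans_le (isBalanced_iff.1 hb v)

/-- The minimum total cost of moving the users to a balanced state. -/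
noncomputable def transportCost (c : V → V → ℝ) (T : V → ℕ) (a : Fin m → V) : ℝ :=
  ⨅ b : {b : Fin m → V // IsBalanced T b}, ∑ i, c (a i) (b.1 i)

variable [Finite V] {c : V → V → ℝ}

theorem transportCost_le (a : Fin m → V) {b : Fin m → V} (hb : IsBalanced T b) :
    transportCost c T a ≤ ∑ i, c (a i) (b i) :=
  ciInf_le (Set.finite_range _).bddBelow (⟨b, hb⟩ : {b : Fin m → V // IsBalanced T b})

theorem exists_eq_transportCost (hT : IsFeasible T m) (a : Fin m → V) :
    ∃ b, IsBalanced T b ∧ ∑ i, c (a i) (b i) = transportCost c T a := by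
  have : Nonempty {b : Fin m → V // IsBalanced T b} := let ⟨b, hb⟩ := hT; ⟨⟨b, hb⟩⟩
  obtain ⟨b, hb⟩ := exists_eq_ciInf_of_finite
    (f := fun b : {b : Fin m → V // IsBalanced T b} => ∑ i, c (a i) (b.1 i))
  exact ⟨b.1, b.2, hb⟩

theorem transportCost_of_isBalanced (hT : IsFeasible T m) (h0 : ∀ v, c v v = 0)
    (h1 : ∀ u v, 0 ≤ c u v) {a : Fin m → V} (ha : IsBalanced T a) : transportCost c T a = 0 := by
  refine le_antisymm ((transportCost_le a ha).trans (by simp [h0])) ?_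
  obtain ⟨b, -, hb⟩ := exists_eq_transportCost (c := c) hT a
  rw [← hb]
  exact Finset.sum_nonneg fun i _ => h1 _ _

theorem one_le_transportCost (hT : IsFeasible T m) (h0 : ∀ v, c v v = 0)
    (h1 : ∀ u v, u ≠ v → 1 ≤ c u v) {a : Fin m → V} (ha : ¬IsBalanced T a) :
    1 ≤ transportCost c T a := by
  obtain ⟨b, hb, hab⟩ := exists_eq_transportCost (c := c) hT a
  have hne : a ≠ b := by rintro rfl; exact ha hb
  obtain ⟨i, hi⟩ := Function.ne_iff.1 hne
  rw [← hab]
  refine (h1 _ _ hi).trans (Finset.single_le_sum (f := fun i => c (a i) (b i)) (fun j _ => ?_)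
    (Finset.mem_univ i))
  by_cases h : a j = b j
  · simp only [h, h0, le_refl]
  · exact zero_le_one.trans (h1 _ _ h)

/-- In an optimal balanced state, exactly the excess users of every resource are moved. -/
theorem card_moved_eq_potential (h0 : ∀ v, c v v = 0) (h1 : ∀ u v, u ≠ v → 1 ≤ c u v)
    (h2 : ∀ u v, c u v ≤ 3 / 2) {a b : Fin m → V} (hb : IsBalanced T b)
    (hab : ∑ i, c (a i) (b i) = transportCost c T a) (v : V) :
    (Finset.univ.filter fun i => a i = v ∧ b i ≠ v).card = potential T a v := by
  have hsplit : (Finset.univ.filter fun i => a i = v ∧ b i = v).card +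
      (Finset.univ.filter fun i => a i = v ∧ b i ≠ v).card = load a v := by
    rw [load, ← Finset.filter_filter, ← Finset.filter_filter]
    exact Finset.card_filter_add_card_filter_not _
  have hbv := isBalanced_iff.1 hb v
  have hstay : (Finset.univ.filter fun i => a i = v ∧ b i = v).card ≤ load b v :=
    Finset.card_le_card fun i => by simp
  by_contra hne
  rw [potential] at hne
  obtain ⟨i, hi⟩ : (Finset.univ.filter fun i => a i = v ∧ b i ≠ v).Nonempty := by
    rw [← Finset.card_pos]; omega
  simp only [Finset.mem_filter, Finset.mem_univ, true_and] at hi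
  obtain ⟨hai, hbi⟩ := hi
  -- Too many users leave v. If the plan leaves room at v, keeping user i there is cheaper. If v is
  -- full, some j arrives from elsewhere; exchanging the targets of i and j replaces two moves, of
  -- cost at least 2, by at most one of cost at most 3/2.
  rcases hbv.lt_or_eq with hlt | heq
  · have hbal : IsBalanced T (Function.update b i v) := by
      refine isBalanced_iff.2 fun u => ?_
      by_cases huv : u = v
      · subst huv
        refine le_trans ?_ hlt
        rw [load, load, Nat.succ_eq_add_one, ← Finset.card_insert_of_notMem
          (s := Finset.univ.filter fun k => b k = u) (a := i) (by simpa using hbi)]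
        refine Finset.card_le_card fun k => ?_
        by_cases hk : k = i <;> simp [hk]
      · refine le_trans (Finset.card_le_card fun k => ?_) (isBalanced_iff.1 hb u)
        by_cases hk : k = i
        · subst hk
          simp [Ne.symm huv]
        · simp [hk]
    have hle := transportCost_le (c := c) a hbal
    rw [← hab] at hle
    refine absurd hle (not_le.2 (Finset.sum_lt_sum (fun k _ => ?_) ⟨i, Finset.mem_univ i, ?_⟩))
    · by_cases hk : k = i
      · subst hk
        rw [Function.update_self, hai, h0]
        linarith [h1 v (b k) (Ne.symm hbi)]
      · rw [Function.update_of_ne hk]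
    · rw [Function.update_self, hai, h0]
      linarith [h1 v (b i) (Ne.symm hbi)]
  · obtain ⟨j, hj, hj'⟩ : ∃ j, j ∈ (Finset.univ.filter fun i => b i = v) ∧
        j ∉ (Finset.univ.filter fun i => a i = v ∧ b i = v) := by
      refine Finset.exists_mem_notMem_of_card_lt_card ?_
      change _ < load b v
      omega
    simp only [Finset.mem_filter, Finset.mem_univ, true_and, not_and'] at hj hj'
    have haj := hj' hj
    have hij : i ≠ j := by rintro rfl; exact hbi hj
    have hle := transportCost_le (c := c) a (hb.comp_perm (Equiv.swap i j))
    rw [← hab, ← sub_nonneg, ← Finset.sum_sub_distrib, Fintype.sum_eq_add i j hij] at hle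
    · simp only [Function.comp, Equiv.swap_apply_left, Equiv.swap_apply_right, hai, hj, h0] at hle
      linarith [h1 v (b i) (Ne.symm hbi), h1 (a j) v haj, h2 (a j) (b i)]
    · intro k hk
      simp [Function.comp, Equiv.swap_apply_of_ne_of_ne hk.1 hk.2]

/-- An optimal balanced state can be chosen such that no user outside `M` is moved away from a
resource on which some user in `M` remains. -/
theorem exists_optimal_priority (hT : IsFeasible T m) (a : Fin m → V) (M : Finset (Fin m)) :
    ∃ b, IsBalanced T b ∧ ∑ i, c (a i) (b i) = transportCost c T a ∧
      ∀ i ∈ M, b i = a i → ∀ j, a j = a i → b j ≠ a j → j ∈ M := by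
  classical
  have := Fintype.ofFinite V
  set O : Finset (Fin m → V) := Finset.univ.filter fun b =>
    IsBalanced T b ∧ ∑ i, c (a i) (b i) = transportCost c T a
  have hO : O.Nonempty := by
    obtain ⟨b, hb⟩ := exists_eq_transportCost (c := c) hT a
    exact ⟨b, by simpa [O] using hb⟩
  -- Among the optimal plans, one that moves the most users of `M` is taken. A violating pair could
  -- exchange targets at equal cost, moving one more user of `M`.
  obtain ⟨b, hbO, hmax⟩ := O.exists_max_image (fun b => (M.filter fun i => b i ≠ a i).card) hO
  simp only [O, Finset.mem_filter, Finset.mem_univ, true_and] at hbO hmax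
  refine ⟨b, hbO.1, hbO.2, fun i hi hbi j hj hbj => ?_⟩
  by_contra hjM
  have hij : i ≠ j := by rintro rfl; exact hjM hi
  have hcost : ∑ k, c (a k) ((b ∘ Equiv.swap i j) k) = transportCost c T a := by
    rw [← hbO.2, ← sub_eq_zero, ← Finset.sum_sub_distrib, Fintype.sum_eq_add i j hij]
    · simp only [Function.comp, Equiv.swap_apply_left, Equiv.swap_apply_right, hj]
      ring
    · intro k hk
      simp [Function.comp, Equiv.swap_apply_of_ne_of_ne hk.1 hk.2]
  refine absurd (hmax _ ⟨hbO.1.comp_perm _, hcost⟩) (not_le.2 (Finset.card_lt_card ?_))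
  rw [Finset.ssubset_iff_of_subset]
  · refine ⟨i, ?_, by simp [hbi]⟩
    simp only [Finset.mem_filter, Function.comp, Equiv.swap_apply_left]
    exact ⟨hi, hj ▸ hbj⟩
  · intro k hk
    simp only [Finset.mem_filter] at hk ⊢
    have hki : k ≠ i := by rintro rfl; exact hk.2 hbi
    have hkj : k ≠ j := by rintro rfl; exact hjM hk.1
    simpa [Function.comp, Equiv.swap_apply_of_ne_of_ne hki hkj] using hk

omit [Finite V] in
theorem sum_comp_eq_sum_load_mul [Fintype V] (a : Fin m → V) (f : V → ℝ) :
    ∑ i, f (a i) = ∑ v, (load a v : ℝ) * f v := by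
  rw [← Finset.sum_fiberwise Finset.univ a]
  refine Finset.sum_congr rfl fun v _ => ?_
  rw [Finset.sum_congr rfl (g := fun _ => f v) (by simp +contextual), Finset.sum_const,
    nsmul_eq_mul, load]

omit [Finite V] in
theorem load_pos (a : Fin m → V) (i : Fin m) : 0 < load a (a i) :=
  Finset.card_pos.2 ⟨i, by simp⟩

/-- Each moved user costs at most 3/2, and Φ_v users of v are moved. Spreading Φ_v evenly over the
users on v gives the ratios that occur in the migration probabilities. -/
theorem transportCost_le_sum_potential (hT : IsFeasible T m) (h0 : ∀ v, c v v = 0)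
    (h1 : ∀ u v, u ≠ v → 1 ≤ c u v) (h2 : ∀ u v, c u v ≤ 3 / 2) (a : Fin m → V) :
    transportCost c T a ≤ 3 / 2 * ∑ i, (potential T a (a i) : ℝ) / load a (a i) := by
  classical
  have := Fintype.ofFinite V
  obtain ⟨b, hb, hab⟩ := exists_eq_transportCost (c := c) hT a
  have hcard : ∑ i, (if b i = a i then (0 : ℝ) else 1) =
      ∑ i, (potential T a (a i) : ℝ) / load a (a i) := by
    rw [sum_comp_eq_sum_load_mul a fun v => (potential T a v : ℝ) / load a v,
      ← Finset.sum_fiberwise Finset.univ a]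
    refine Finset.sum_congr rfl fun v _ => ?_
    rw [← card_moved_eq_potential h0 h1 h2 hb hab v]
    have e : ∑ i with a i = v, (if b i = a i then (0 : ℝ) else 1) =
        (Finset.univ.filter fun i => a i = v ∧ b i ≠ v).card := by
      rw [← Finset.filter_filter, Finset.card_filter]
      push_cast
      refine Finset.sum_congr rfl fun i hi => ?_
      rw [(Finset.mem_filter.1 hi).2]
      split_ifs <;> simp_all
    rw [e]
    by_cases hv : load a v = 0
    · rw [hv]
      have hle : (Finset.univ.filter fun i => a i = v ∧ b i ≠ v).card ≤ load a v :=
        Finset.card_le_card fun i => by simp +contextual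
      rw [hv] at hle
      simp [Nat.le_zero.1 hle]
    · field_simp
  rw [← hab, ← hcard, Finset.mul_sum]
  refine Finset.sum_le_sum fun i _ => ?_
  split_ifs with h
  · simp [h, h0]
  · simpa using h2 _ _

/-- The number of users in `M` that cannot be matched with an excess user is at most the number of
pairs of users in `M` on a common resource, with weights given by the potentials. -/
theorem card_unmoved_le (h0 : ∀ v, c v v = 0) (h1 : ∀ u v, u ≠ v → 1 ≤ c u v)
    (h2 : ∀ u v, c u v ≤ 3 / 2) {a b : Fin m → V} (hb : IsBalanced T b)
    (hab : ∑ i, c (a i) (b i) = transportCost c T a) {M : Finset (Fin m)}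
    (hM : ∀ i ∈ M, b i = a i → ∀ j, a j = a i → b j ≠ a j → j ∈ M)
    (hpos : ∀ i ∈ M, potential T a (a i) ≠ 0) :
    ∑ i ∈ M, (if b i = a i then (1 : ℝ) else 0) ≤
      ∑ i, ∑ j, if i ≠ j ∧ a j = a i then
        (if {i, j} ⊆ M then ((potential T a (a i) : ℝ))⁻¹ else 0) else 0 := by
  have hnn : ∀ i j, (0 : ℝ) ≤ if i ≠ j ∧ a j = a i then
        (if {i, j} ⊆ M then ((potential T a (a i) : ℝ))⁻¹ else 0) else 0 := by
    intro i j
    split_ifs <;> positivity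
  refine le_trans ?_ (Finset.sum_le_sum_of_subset_of_nonneg (Finset.subset_univ M)
    fun i _ _ => Finset.sum_nonneg fun j _ => hnn i j)
  refine Finset.sum_le_sum fun i hi => ?_
  split_ifs with hbi
  swap
  · exact Finset.sum_nonneg fun j _ => hnn i j
  -- All Φ users moved away from the resource of i are in `M`, so each pairs with i and contributes
  -- 1/Φ, for a total of 1.
  refine le_trans ?_ (Finset.sum_le_sum_of_subset_of_nonneg
    (Finset.subset_univ (Finset.univ.filter fun j => a j = a i ∧ b j ≠ a i)) fun j _ _ => hnn i j)
  rw [Finset.sum_congr rfl (g := fun _ => ((potential T a (a i) : ℝ))⁻¹), Finset.sum_const,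
    card_moved_eq_potential h0 h1 h2 hb hab, nsmul_eq_mul,
    mul_inv_cancel₀ (by exact_mod_cast hpos i hi)]
  intro j hj
  simp only [Finset.mem_filter, Finset.mem_univ, true_and] at hj
  have hij : i ≠ j := by rintro rfl; exact hj.2 hbi
  have hjM := hM i hi hbi j hj.1 (hj.1.symm ▸ hj.2)
  rw [if_pos ⟨hij, hj.1⟩, if_pos]
  simp [Finset.insert_subset_iff, hi, hjM]

end TransportCost

/-! ### Random subsets and product measures -/

section ProductMeasures

variable {ι V : Type*} [Fintype ι] [DecidableEq ι]

theorem prod_add_eq_sum_finset (f g : ι → ℝ) :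
    ∏ i, (f i + g i) = ∑ M : Finset ι, ∏ i, if i ∈ M then f i else g i := by
  rw [Finset.prod_add, Finset.powerset_univ]
  refine Finset.sum_congr rfl fun M _ => ?_
  rw [Finset.prod_ite, Finset.filter_mem_eq_inter, Finset.univ_inter]
  congr 2
  ext; simp

/-- The probability that a set of independently chosen elements contains `S`. -/
theorem sum_prod_ite_subset (p : ι → ℝ) (S : Finset ι) :
    ∑ M : Finset ι, (∏ i, if i ∈ M then p i else 1 - p i) * (if S ⊆ M then 1 else 0) =
      ∏ i ∈ S, p i := by
  -- Setting the exclusion weight to 0 on `S` leaves exactly the sets that contain `S`.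
  have h := prod_add_eq_sum_finset p fun i => if i ∈ S then 0 else 1 - p i
  have e : ∏ i, (p i + if i ∈ S then 0 else 1 - p i) = ∏ i ∈ S, p i := by
    rw [show ∏ i ∈ S, p i = ∏ i, if i ∈ S then p i else 1 by simp]
    refine Finset.prod_congr rfl fun i _ => ?_
    split_ifs <;> ring
  rw [← e, h]
  refine Finset.sum_congr rfl fun M _ => ?_
  split_ifs with hSM
  · rw [mul_one]
    refine Finset.prod_congr rfl fun i _ => ?_
    split_ifs with hiM hiS
    · rfl
    · exact absurd (hSM hiS) hiM
    · rfl
  · obtain ⟨i, hiS, hiM⟩ := Finset.not_subset.1 hSM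
    rw [mul_zero]
    exact (Finset.prod_eq_zero (Finset.mem_univ i) (by simp [hiS, hiM])).symm

theorem sum_prod_mul_apply [Fintype V] (k : ι → V → ℝ) (hk : ∀ i, ∑ w, k i w = 1) (j : ι)
    (g : V → ℝ) : ∑ b : ι → V, (∏ i, k i (b i)) * g (b j) = ∑ w, k j w * g w := by
  have h := Fintype.prod_sum (fun i w => k i w * if i = j then g w else 1)
  have e : ∀ b : ι → V, ∏ i, (k i (b i) * if i = j then g (b i) else 1) =
      (∏ i, k i (b i)) * g (b j) := by
    intro b
    rw [Finset.prod_mul_distrib, Finset.prod_ite_eq' Finset.univ j, if_pos (Finset.mem_univ j)]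
  simp_rw [e] at h
  rw [← h, Finset.prod_eq_single j]
  · simp
  · intro i _ hij
    simp [hij, hk]
  · simp

end ProductMeasures

/-! ### Drift of the transport cost -/

section Drift

variable {V : Type*} [Fintype V] [DecidableEq V] {G : SimpleGraph V} [DecidableRel G.Adj] {m : ℕ}

theorem toReal_userStep (α : ℝ≥0) (hα : α ≤ 1) (T : V → ℕ) (a : Fin m → V) (i : Fin m) (w : V) :
    (userStep G α hα T a i w).toReal =
      (migrationProb α T a (a i) : ℝ) * (randomNeighbor G (a i) w).toReal +
        (1 - (migrationProb α T a (a i) : ℝ)) * (PMF.pure (a i) w).toReal := by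
  have hp := migrationProb_le_one hα T a (a i)
  have h1 : (1 - (migrationProb α T a (a i) : ℝ≥0∞)) ≠ ∞ := ENNReal.sub_ne_top ENNReal.one_ne_top
  rw [userStep, PMF.bind_apply, tsum_bool, ENNReal.toReal_add
    (ENNReal.mul_ne_top (PMF.apply_ne_top _ _) (PMF.apply_ne_top _ _))
    (ENNReal.mul_ne_top (PMF.apply_ne_top _ _) (PMF.apply_ne_top _ _)), ENNReal.toReal_mul,
    ENNReal.toReal_mul, add_comm]
  simp only [coin, PMF.ofFintype_apply, if_true, Bool.false_eq_true, if_false, ENNReal.coe_toReal]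
  rw [ENNReal.toReal_sub_of_le (by exact_mod_cast hp) ENNReal.one_ne_top, ENNReal.toReal_one,
    ENNReal.coe_toReal]

/-- Given the set `M` of migrating users, the distribution of the resource of user `i`. -/
noncomputable def moveKernel (G : SimpleGraph V) [DecidableRel G.Adj] (a : Fin m → V)
    (M : Finset (Fin m)) (i : Fin m) (w : V) : ℝ :=
  if i ∈ M then (randomNeighbor G (a i) w).toReal else (PMF.pure (a i) w).toReal

omit [DecidableEq V] in
theorem moveKernel_nonneg (a : Fin m → V) (M : Finset (Fin m)) (i : Fin m) (w : V) :
    0 ≤ moveKernel G a M i w := by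
  unfold moveKernel
  split_ifs <;> exact ENNReal.toReal_nonneg

omit [DecidableEq V] in
theorem sum_moveKernel (a : Fin m → V) (M : Finset (Fin m)) (i : Fin m) :
    ∑ w, moveKernel G a M i w = 1 := by
  unfold moveKernel
  split_ifs <;> exact sum_toReal_eq_one _

theorem toReal_protocolStep (α : ℝ≥0) (hα : α ≤ 1) (T : V → ℕ) (a b : Fin m → V) :
    (protocolStep G α hα T a b).toReal =
      ∑ M : Finset (Fin m), (∏ i, if i ∈ M then (migrationProb α T a (a i) : ℝ)
        else 1 - (migrationProb α T a (a i) : ℝ)) * ∏ i, moveKernel G a M i (b i) := by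
  rw [protocolStep, PMF.ofFintype_apply, ENNReal.toReal_prod]
  simp_rw [toReal_userStep]
  rw [prod_add_eq_sum_finset]
  refine Finset.sum_congr rfl fun M _ => ?_
  rw [← Finset.prod_mul_distrib]
  refine Finset.prod_congr rfl fun i _ => ?_
  rw [moveKernel]
  split_ifs <;> rfl

/-- The migrant set is fixed before the destinations are drawn, so a single plan adapted to `M`
serves as a competitor for every outcome. An unmoved migrant has cost at most 3/2 ≤ 2 - ε
afterwards, which explains the factor 2. -/
theorem sum_prod_moveKernel_mul_transportCost_le {c : V → V → ℝ} {T : V → ℕ} {ε : ℝ}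
    (hT : IsFeasible T m) (h0 : ∀ v, c v v = 0) (h1 : ∀ u v, u ≠ v → 1 ≤ c u v)
    (h2 : ∀ u v, c u v ≤ 3 / 2) (hε : ε ≤ 1 / 2)
    (hc : ∀ u v, u ≠ v → ∑ w, (randomNeighbor G u w).toReal * c w v ≤ c u v - ε)
    (a : Fin m → V) {M : Finset (Fin m)} (hpos : ∀ i ∈ M, potential T a (a i) ≠ 0) :
    ∑ b : Fin m → V, (∏ i, moveKernel G a M i (b i)) * transportCost c T b ≤
      transportCost c T a - ε * (∑ i, if i ∈ M then 1 else 0) +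
        2 * ∑ i, ∑ j, if i ≠ j ∧ a j = a i then
          (if {i, j} ⊆ M then ((potential T a (a i) : ℝ))⁻¹ else 0) else 0 := by
  obtain ⟨b, hb, hab, hM⟩ := exists_optimal_priority (c := c) hT a M
  have hU := card_unmoved_le h0 h1 h2 hb hab hM hpos
  have hstep : ∀ i, ∑ w, moveKernel G a M i w * c w (b i) ≤
      c (a i) (b i) - ε * (if i ∈ M then 1 else 0) +
        2 * (if i ∈ M then (if b i = a i then (1 : ℝ) else 0) else 0) := by
    intro i
    simp only [moveKernel]
    by_cases hi : i ∈ M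
    · simp only [hi, if_true]
      by_cases hbi : b i = a i
      · rw [if_pos hbi, hbi, h0]
        have : ∑ w, (randomNeighbor G (a i) w).toReal * c w (a i) ≤
            ∑ w, (randomNeighbor G (a i) w).toReal * (3 / 2) :=
          Finset.sum_le_sum fun w _ => mul_le_mul_of_nonneg_left (h2 _ _) ENNReal.toReal_nonneg
        rw [← Finset.sum_mul, sum_toReal_eq_one] at this
        linarith
      · rw [if_neg hbi]
        linarith [hc (a i) (b i) (Ne.symm hbi)]
    · simp only [hi, if_false]
      rw [Finset.sum_eq_single (a i)]
      · simp
      · intro w _ hw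
        simp [hw]
      · simp
  calc ∑ b' : Fin m → V, (∏ i, moveKernel G a M i (b' i)) * transportCost c T b'
      ≤ ∑ b' : Fin m → V, (∏ i, moveKernel G a M i (b' i)) * ∑ j, c (b' j) (b j) :=
        Finset.sum_le_sum fun b' _ => mul_le_mul_of_nonneg_left (transportCost_le b' hb)
          (Finset.prod_nonneg fun i _ => moveKernel_nonneg a M i _)
    _ = ∑ j, ∑ w, moveKernel G a M j w * c w (b j) := by
        simp_rw [Finset.mul_sum]
        rw [Finset.sum_comm]
        exact Finset.sum_congr rfl fun j _ =>
          sum_prod_mul_apply _ (sum_moveKernel a M) j fun w => c w (b j)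
    _ ≤ ∑ i, (c (a i) (b i) - ε * (if i ∈ M then 1 else 0) +
        2 * (if i ∈ M then (if b i = a i then (1 : ℝ) else 0) else 0)) :=
        Finset.sum_le_sum fun i _ => hstep i
    _ = transportCost c T a - ε * (∑ i, if i ∈ M then 1 else 0) +
        2 * ∑ i ∈ M, (if b i = a i then (1 : ℝ) else 0) := by
        rw [Finset.sum_add_distrib, Finset.sum_sub_distrib, hab, ← Finset.mul_sum,
          ← Finset.mul_sum, Finset.sum_ite_mem _ _ fun i => if b i = a i then (1 : ℝ) else 0,
          Finset.univ_inter]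
    _ ≤ _ := by linarith

omit [Fintype V] in
theorem coe_migrationProb (α : ℝ≥0) (T : V → ℕ) (a : Fin m → V) (v : V) :
    (migrationProb α T a v : ℝ) = α * ((potential T a v : ℝ) / load a v) := by
  simp [migrationProb]

theorem sum_protocolStep_mul_transportCost_le_sub {c : V → V → ℝ} {T : V → ℕ} {ε : ℝ} {α : ℝ≥0}
    (hα : α ≤ 1) (hT : IsFeasible T m) (h0 : ∀ v, c v v = 0) (h1 : ∀ u v, u ≠ v → 1 ≤ c u v)
    (h2 : ∀ u v, c u v ≤ 3 / 2) (hε : ε ≤ 1 / 2)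
    (hc : ∀ u v, u ≠ v → ∑ w, (randomNeighbor G u w).toReal * c w v ≤ c u v - ε)
    (a : Fin m → V) :
    ∑ b : Fin m → V, (protocolStep G α hα T a b).toReal * transportCost c T b ≤
      transportCost c T a - (ε - 2 * α) * ∑ i, (migrationProb α T a (a i) : ℝ) := by
  set p : Fin m → ℝ := fun i => (migrationProb α T a (a i) : ℝ) with hp
  have hp0 : ∀ i, 0 ≤ p i := fun i => NNReal.coe_nonneg _
  have hp1 : ∀ i, 0 ≤ 1 - p i := fun i => by
    have : p i ≤ 1 := by exact_mod_cast migrationProb_le_one hα T a (a i)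
    linarith
  set W : Finset (Fin m) → ℝ := fun M => ∏ i, if i ∈ M then p i else 1 - p i with hW
  have hW0 : ∀ M, 0 ≤ W M := fun M => Finset.prod_nonneg fun i _ => by
    split_ifs
    exacts [hp0 i, hp1 i]
  have hWpos : ∀ M, W M ≠ 0 → ∀ i ∈ M, potential T a (a i) ≠ 0 := by
    intro M hM i hi h
    refine hM (Finset.prod_eq_zero (Finset.mem_univ i) ?_)
    rw [if_pos hi, hp]
    simp [coe_migrationProb, h]
  have hmom : ∀ S : Finset (Fin m), ∑ M, W M * (if S ⊆ M then 1 else 0) = ∏ i ∈ S, p i :=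
    sum_prod_ite_subset p
  have hmass : ∑ M, W M = 1 := by simpa using hmom ∅
  have hfirst : ∀ i, ∑ M, W M * (if i ∈ M then 1 else 0) = p i := by
    intro i
    simpa using hmom {i}
  have hsecond : ∑ M, W M * (∑ i, ∑ j, if i ≠ j ∧ a j = a i then
      (if {i, j} ⊆ M then ((potential T a (a i) : ℝ))⁻¹ else 0) else 0) ≤ α * ∑ i, p i := by
    simp_rw [Finset.mul_sum]
    rw [Finset.sum_comm]
    refine Finset.sum_le_sum fun i _ => ?_
    rw [Finset.sum_comm]
    -- For distinct users on one resource with Φ ≠ 0, p_j / Φ = α / load. Admitting j = i as well on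
    -- the right makes the sum over the users on the resource exactly α p_i.
    have hj : ∀ j, ∑ M, W M * (if i ≠ j ∧ a j = a i then
        (if {i, j} ⊆ M then ((potential T a (a i) : ℝ))⁻¹ else 0) else 0) ≤
        if a j = a i then p i * (α / load a (a i)) else 0 := by
      intro j
      by_cases hji : a j = a i
      swap
      · simp [hji]
      by_cases hij : i = j
      · simp only [hij, ne_eq, not_true_eq_false, false_and, if_false, mul_zero,
          Finset.sum_const_zero, if_true]
        exact mul_nonneg (hp0 j) (by positivity)
      simp only [hji, hij, ne_eq, not_false_eq_true, and_self, if_true]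
      calc ∑ M, W M * (if {i, j} ⊆ M then ((potential T a (a i) : ℝ))⁻¹ else 0)
          = (∑ M, W M * (if {i, j} ⊆ M then 1 else 0)) * ((potential T a (a i) : ℝ))⁻¹ := by
            rw [Finset.sum_mul]
            refine Finset.sum_congr rfl fun M _ => ?_
            split_ifs <;> ring
        _ = p i * (p j * ((potential T a (a i) : ℝ))⁻¹) := by
            rw [hmom, Finset.prod_pair hij, mul_assoc]
        _ ≤ p i * (α / load a (a i)) := by
            refine mul_le_mul_of_nonneg_left ?_ (hp0 i)
            simp only [hp, coe_migrationProb, hji]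
            by_cases hz : (potential T a (a i) : ℝ) = 0
            · rw [hz]
              simp only [inv_zero, mul_zero]
              positivity
            · refine le_of_eq ?_
              field_simp
    refine (Finset.sum_le_sum fun j _ => hj j).trans (le_of_eq ?_)
    rw [← Finset.sum_filter, Finset.sum_const, nsmul_eq_mul]
    have hl : ((Finset.univ.filter fun j => a j = a i).card : ℝ) = load a (a i) := rfl
    have hl0 : (load a (a i) : ℝ) ≠ 0 := by exact_mod_cast (load_pos a i).ne'
    rw [hl]
    field_simp
  have hM : ∀ M, W M * ∑ b : Fin m → V, (∏ i, moveKernel G a M i (b i)) * transportCost c T b ≤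
      W M * (transportCost c T a - ε * (∑ i, if i ∈ M then 1 else 0) +
        2 * ∑ i, ∑ j, if i ≠ j ∧ a j = a i then
          (if {i, j} ⊆ M then ((potential T a (a i) : ℝ))⁻¹ else 0) else 0) := by
    intro M
    by_cases h : W M = 0
    · simp [h]
    · exact mul_le_mul_of_nonneg_left (sum_prod_moveKernel_mul_transportCost_le hT h0 h1 h2 hε hc a
        (hWpos M h)) (hW0 M)
  calc ∑ b : Fin m → V, (protocolStep G α hα T a b).toReal * transportCost c T b
      = ∑ M, W M * ∑ b : Fin m → V, (∏ i, moveKernel G a M i (b i)) * transportCost c T b := by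
        simp_rw [toReal_protocolStep, Finset.sum_mul, Finset.mul_sum]
        rw [Finset.sum_comm]
        refine Finset.sum_congr rfl fun M _ => Finset.sum_congr rfl fun b _ => ?_
        rw [← mul_assoc]
    _ ≤ ∑ M, W M * (transportCost c T a - ε * (∑ i, if i ∈ M then 1 else 0) +
        2 * ∑ i, ∑ j, if i ≠ j ∧ a j = a i then
          (if {i, j} ⊆ M then ((potential T a (a i) : ℝ))⁻¹ else 0) else 0) :=
        Finset.sum_le_sum fun M _ => hM M
    _ = transportCost c T a - ε * ∑ i, p i + 2 * ∑ M, W M * (∑ i, ∑ j, if i ≠ j ∧ a j = a i then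
          (if {i, j} ⊆ M then ((potential T a (a i) : ℝ))⁻¹ else 0) else 0) := by
        have e : ∑ M, W M * (∑ i, if i ∈ M then (1 : ℝ) else 0) = ∑ i, p i := by
          simp_rw [Finset.mul_sum]
          rw [Finset.sum_comm]
          exact Finset.sum_congr rfl fun i _ => hfirst i
        have e' : ∑ M, W M * transportCost c T a = transportCost c T a := by
          rw [← Finset.sum_mul, hmass, one_mul]
        conv_rhs => rw [← e, ← e', Finset.mul_sum, Finset.mul_sum, ← Finset.sum_sub_distrib,
          ← Finset.sum_add_distrib]
        exact Finset.sum_congr rfl fun M _ => by ring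
    _ ≤ _ := by linarith

theorem sum_protocolStep_mul_transportCost_le {c : V → V → ℝ} {T : V → ℕ} {ε : ℝ} {α : ℝ≥0}
    (hα : α ≤ 1) (hT : IsFeasible T m) (h0 : ∀ v, c v v = 0) (h1 : ∀ u v, u ≠ v → 1 ≤ c u v)
    (h2 : ∀ u v, c u v ≤ 3 / 2) (hε : ε ≤ 1 / 2) (hεα : 4 * α ≤ ε)
    (hc : ∀ u v, u ≠ v → ∑ w, (randomNeighbor G u w).toReal * c w v ≤ c u v - ε)
    (a : Fin m → V) :
    ∑ b : Fin m → V, (protocolStep G α hα T a b).toReal * transportCost c T b ≤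
      (1 - α * ε / 3) * transportCost c T a := by
  have hα0 : (0 : ℝ) ≤ α := α.2
  have hS := transportCost_le_sum_potential hT h0 h1 h2 a
  set S : ℝ := ∑ i, (potential T a (a i) : ℝ) / load a (a i)
  have hS0 : 0 ≤ S := Finset.sum_nonneg fun i _ => by positivity
  have hp : ∑ i, (migrationProb α T a (a i) : ℝ) = α * S := by
    rw [Finset.mul_sum]
    exact Finset.sum_congr rfl fun i _ => coe_migrationProb α T a (a i)
  have key := sum_protocolStep_mul_transportCost_le_sub hα hT h0 h1 h2 hε hc a
  rw [hp] at key
  -- Half of ε absorbs the loss 2α; with W ≤ (3/2) S, the remaining α ε S / 2 is at least (α ε / 3)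
  -- W.
  have e1 : ε / 2 * (α * S) ≤ (ε - 2 * α) * (α * S) :=
    mul_le_mul_of_nonneg_right (by linarith) (by positivity)
  have e2 : α * ε / 3 * transportCost c T a ≤ α * ε / 3 * (3 / 2 * S) :=
    mul_le_mul_of_nonneg_left hS (by
      have : 0 ≤ ε := by linarith
      positivity)
  linarith

/-- Multiplicative drift: if a function that is `0` on `A` and at least `1` elsewhere decreases in
expectation by the factor `1 - δ` in every step, then `A` is hit after an expected number of at most
`(1 + log (W s)) / δ` steps. -/
theorem expectedHittingTime_le_of_multiplicative_drift {S : Type*} [Fintype S] (P : S → PMF S)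
    (A : Set S) (W : S → ℝ) {δ : ℝ} (hδ : 0 < δ) (hA : ∀ s ∈ A, W s = 0) (hA' : ∀ s ∉ A, 1 ≤ W s)
    (hW : ∀ s ∉ A, ∑ s', (P s s').toReal * W s' ≤ (1 - δ) * W s) {s : S} (hs : s ∉ A) :
    expectedHittingTime P A s ≤ ENNReal.ofReal ((1 + Real.log (W s)) / δ) := by
  classical
  set L : S → ℝ := fun s => if s ∈ A then 0 else (1 + Real.log (W s)) / δ with hL
  have hL0 : ∀ s, 0 ≤ L s := by
    intro s
    simp only [hL]
    split_ifs with h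
    · rfl
    · have := Real.log_nonneg (hA' s h)
      positivity
  have hmain : ∀ s ∉ A, 1 + ∑ s', (P s s').toReal * L s' ≤ L s := by
    intro s hs
    have hws := hA' s hs
    have hws0 : 0 < W s := by linarith
    have hlog := Real.log_nonneg hws
    -- Since log x ≤ x - 1, the logarithm is bounded by its tangent at `W s`, which is affine in `W
    -- s'` and can be averaged. On `A` the bound holds because `L` is set to 0 there.
    have hb : ∀ s', L s' ≤ (Real.log (W s) + W s' / W s) / δ := by
      intro s'
      simp only [hL]
      split_ifs with h
      · rw [hA s' h]
        simp only [zero_div, add_zero]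
        positivity
      · have hws' := hA' s' h
        have := Real.log_le_sub_one_of_pos (x := W s' / W s) (by positivity)
        rw [Real.log_div (by positivity) (by positivity)] at this
        refine div_le_div_of_nonneg_right ?_ hδ.le
        linarith
    have h1 : ∑ s', (P s s').toReal * L s' ≤ (Real.log (W s) + (1 - δ)) / δ := by
      calc ∑ s', (P s s').toReal * L s'
          ≤ ∑ s', (P s s').toReal * ((Real.log (W s) + W s' / W s) / δ) :=
            Finset.sum_le_sum fun s' _ => mul_le_mul_of_nonneg_left (hb s') ENNReal.toReal_nonneg
        _ = (Real.log (W s) * ∑ s', (P s s').toReal +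
              (∑ s', (P s s').toReal * W s') / W s) / δ := by
            rw [Finset.mul_sum, Finset.sum_div, ← Finset.sum_add_distrib, Finset.sum_div]
            exact Finset.sum_congr rfl fun s' _ => by ring
        _ ≤ (Real.log (W s) + (1 - δ)) / δ := by
            rw [sum_toReal_eq_one, mul_one]
            refine div_le_div_of_nonneg_right (add_le_add le_rfl ?_) hδ.le
            rw [div_le_iff₀ hws0]
            exact hW s hs
    have h2 : (Real.log (W s) + (1 - δ)) / δ = (1 + Real.log (W s)) / δ - 1 := by
      field_simp
      ring
    simp only [hL, hs, if_false]
    simp only [hL] at h1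
    linarith
  have hfin := expectedHittingTime_le_of_drift P A (fun s => ENNReal.ofReal (L s)) (fun s hs => ?_) s
  · simpa only [hL, hs, if_false] using hfin
  · refine le_trans (le_of_eq ?_) (ENNReal.ofReal_le_ofReal (hmain s hs))
    rw [ENNReal.ofReal_add zero_le_one (Finset.sum_nonneg fun s' _ =>
      mul_nonneg ENNReal.toReal_nonneg (hL0 s')), ENNReal.ofReal_one, tsum_fintype,
      ENNReal.ofReal_sum_of_nonneg fun s' _ => mul_nonneg ENNReal.toReal_nonneg (hL0 s')]
    congr 1
    refine Finset.sum_congr rfl fun s' _ => ?_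
    rw [ENNReal.ofReal_mul ENNReal.toReal_nonneg, ENNReal.ofReal_toReal (PMF.apply_ne_top _ _)]

theorem expectedRounds_le_of_nontrivial [Nontrivial V] (hG : G.Connected)
    (hH : maxHittingTime G ≠ ∞) (hm : 2 ≤ m) {T : V → ℕ} (hT : IsFeasible T m) {a : Fin m → V}
    (ha : ¬IsBalanced T a) :
    expectedRounds G (((Fintype.card V : ℝ≥0) ^ 5)⁻¹) (inv_pow_five_le_one (Fintype.card V)) T a ≤
      ENNReal.ofReal (24 * (Fintype.card V : ℝ) ^ 5 * Real.log m * (maxHittingTime G).toReal) := by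
  set n : ℝ := (Fintype.card V : ℝ) with hn
  set H : ℝ := (maxHittingTime G).toReal with hHdef
  have hn2 : 2 ≤ n := by
    rw [hn]
    exact_mod_cast Fintype.one_lt_card
  have hH1 : 1 ≤ H := by
    have := ENNReal.toReal_mono hH (one_le_maxHittingTime (G := G))
    simpa using this
  have hHn : 8 * H ≤ n ^ 5 := by
    have h1 : H ≤ n ^ 2 * (n - 1) := maxHittingTime_toReal_le hG hH
    -- Equality holds at n = 2; with t = n - 2 the difference is t³ + 6t² + 4t.
    have h2 : 8 * (n - 1) ≤ n ^ 3 := by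
      nlinarith [mul_nonneg (sub_nonneg.2 hn2) (sub_nonneg.2 hn2), mul_nonneg
        (mul_nonneg (sub_nonneg.2 hn2) (sub_nonneg.2 hn2)) (sub_nonneg.2 hn2)]
    nlinarith [mul_le_mul_of_nonneg_left h2 (sq_nonneg n)]
  have hα : ((((Fintype.card V : ℝ≥0) ^ 5)⁻¹ : ℝ≥0) : ℝ) = (n ^ 5)⁻¹ := by simp [hn]
  have hc1 : ∀ u v : V, u ≠ v → 1 ≤ hittingCost G u v := fun u v => one_le_hittingCost
  have hε : 1 / (2 * H) ≤ 1 / 2 := one_div_le_one_div_of_le (by norm_num) (by linarith)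
  have hεα : 4 * ((((Fintype.card V : ℝ≥0) ^ 5)⁻¹ : ℝ≥0) : ℝ) ≤ 1 / (2 * H) := by
    rw [hα, ← div_eq_mul_inv, div_le_div_iff₀ (by positivity) (by positivity)]
    linarith
  have hδ : 0 < (n ^ 5)⁻¹ * (1 / (2 * H)) / 3 := by positivity
  have key := expectedHittingTime_le_of_multiplicative_drift
    (protocolStep G (((Fintype.card V : ℝ≥0) ^ 5)⁻¹) (inv_pow_five_le_one (Fintype.card V)) T)
    {b : Fin m → V | IsBalanced T b} (transportCost (hittingCost G) T) hδ
    (fun b hb => transportCost_of_isBalanced hT hittingCost_self (fun u v => by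
      by_cases h : u = v
      · rw [h, hittingCost_self]
      · exact zero_le_one.trans (hc1 u v h)) hb)
    (fun b hb => one_le_transportCost hT hittingCost_self hc1 hb)
    (fun b _ => by
      rw [← hα]
      exact sum_protocolStep_mul_transportCost_le _ hT hittingCost_self hc1
        (hittingCost_le hH) hε hεα (fun u v => sum_mul_hittingCost_le hH) b) (s := a) ha
  refine key.trans (ENNReal.ofReal_le_ofReal ?_)
  have hm' : (2 : ℝ) ≤ m := by exact_mod_cast hm
  have hW1 := one_le_transportCost hT hittingCost_self hc1 ha
  have hW2 : transportCost (hittingCost G) T a ≤ 3 / 2 * m := by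
    obtain ⟨b, hb⟩ := id hT
    refine (transportCost_le a hb).trans ?_
    refine (Finset.sum_le_sum fun i _ => hittingCost_le hH (a i) (b i)).trans (le_of_eq ?_)
    simp [mul_comm]
  have hlogm : Real.log 2 ≤ Real.log m := Real.log_le_log (by norm_num) hm'
  have hlogW : Real.log (transportCost (hittingCost G) T a) ≤ Real.log 2 + Real.log m := by
    rw [← Real.log_mul (by norm_num) (by positivity)]
    exact Real.log_le_log (by linarith) (by linarith)
  have hlog2 := Real.log_two_gt_d9
  -- As W ≤ 2m and m ≥ 2, it suffices that 1 ≤ 2 log 2. The factor 4 here times the 6 from 1/δ gives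
  -- the constant 24.
  have hfin : 1 + Real.log (transportCost (hittingCost G) T a) ≤ 4 * Real.log m := by linarith
  calc (1 + Real.log (transportCost (hittingCost G) T a)) / ((n ^ 5)⁻¹ * (1 / (2 * H)) / 3)
      = (1 + Real.log (transportCost (hittingCost G) T a)) * (6 * n ^ 5 * H) := by
        field_simp
        ring
    _ ≤ 4 * Real.log m * (6 * n ^ 5 * H) := mul_le_mul_of_nonneg_right hfin (by positivity)
    _ = 24 * n ^ 5 * Real.log m * H := by ring

end Drift

end ThresholdBalancing

/-! ### The main bound -/

theorem mainTheorem7 :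
    ∃ C : ℝ, 0 < C ∧
      ∀ (V : Type*) [Fintype V] [DecidableEq V] (G : SimpleGraph V) [DecidableRel G.Adj],
        G.Connected →
        ∀ (m : ℕ), 2 ≤ m →
        ∀ (T : V → ℕ), ThresholdBalancing.IsFeasible T m →
        ∀ (a : Fin m → V),
          ThresholdBalancing.expectedRounds G (((Fintype.card V : ℝ≥0) ^ 5)⁻¹)
              (ThresholdBalancing.inv_pow_five_le_one (Fintype.card V)) T a ≤
            ENNReal.ofReal (C * (Fintype.card V : ℝ) ^ 5 * Real.log m) *
              ThresholdBalancing.maxHittingTime G := by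
  refine ⟨24, by norm_num, fun V _ _ G _ hG m hm T hT a => ?_⟩
  by_cases ha : ThresholdBalancing.IsBalanced T a
  · exact (ThresholdBalancing.expectedHittingTime_of_mem _ ha).trans_le zero_le
  -- On a single vertex there is only one state, and feasibility makes it balanced.
  have hV : Nontrivial V := by
    by_contra h
    rw [not_nontrivial_iff_subsingleton] at h
    obtain ⟨b, hb⟩ := hT
    exact ha (Subsingleton.elim b a ▸ hb)
  have hlog : 0 < Real.log m := Real.log_pos (by exact_mod_cast hm)
  have hC : 0 < 24 * (Fintype.card V : ℝ) ^ 5 * Real.log m := by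
    have : 0 < Fintype.card V := Fintype.card_pos
    positivity
  -- Finiteness of H(G) need not be proved: were it infinite, the right-hand side would be too, its
  -- other factor being positive.
  by_cases hH : ThresholdBalancing.maxHittingTime G = ∞
  · rw [hH, ENNReal.mul_top (ENNReal.ofReal_pos.2 hC).ne']
    exact le_top
  · refine (ThresholdBalancing.expectedRounds_le_of_nontrivial hG hH hm hT ha).trans ?_
    rw [ENNReal.ofReal_mul hC.le, ENNReal.ofReal_toReal hH]
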